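/- Let $R(\alpha,\beta,\gamma)=R_z(\alpha)R_y(\beta)R_z(\gamma)$, $\alpha,\beta,\gamma\in\mathbb T=\mathbb R/2\pi\mathbb Z$, be the Euler angle parametrization of $SO(3)$, and let $\mu$ be the Haar probability measure of $SO(3)$. For $n\in\mathbb N_0$ and integers $|k|,|l|\le n$ let $D_n^{k,l}\colon SO(3)\to\mathbb C$ be the $L^2$-normalized Wigner-D function $$D_n^{k,l}(R(\alpha,\beta,\gamma))=\sqrt{2n+1}\,e^{-ik\alpha}\,d_n^{k,l}(\cos\beta)\,e^{-il\gamma},\qquad \alpha,\gamma\in\mathbb T,\ \beta\in[0,\pi],$$ $$d_n^{k,l}(x)=(-1)^{\nu}\binom{2n-s}{s+a}^{1/2}\binom{s+b}{b}^{-1/2}\Big(\frac{1-x}{2}\Big)^{a/2}\Big(\frac{1+x}{2}\Big)^{b/2}P_s^{(a,b)}(x),\qquad x\in[-1,1],$$ where $a=|k-l|$, $b=|k+l|$, $s=n-\max\{|k|,|l|\}$, $\nu=k+l$ if $k>l$ and $\nu=0$ otherwise, and $P_s^{(a,b)}$ is the Jacobi polynomial. Let $N\in\mathbb N_0$ and let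 $f\colon SO(3)\to\mathbb C$ be $N$-band-limited, that is, $f\in\operatorname{span}\{D_n^{k,l}: 0\le n\le N,\ |k|,|l|\le n\}$. Let $\hat f_n^{k,l}=\int_{SO(3)} f\,\overline{D_n^{k,l}}\,d\mu$ be its harmonic coefficients, let $$\hat g_{k,j,l}=i^{k-l}\sum_{n=\max\{|k|,|l|,|j|\}}^{N}\sqrt{2n+1}\;d_n^{j,k}(0)\,d_n^{j,l}(0)\,\hat f_n^{-k,-l},\qquad k,j,l\in\{-N,\dots,N\},$$ be the Wigner transform of $\hat f$, and let $$c_{k,j,l}=\frac1{(2\pi)^3}\int_{\mathbb T^3} f(R(\alpha,\beta,\gamma))\,e^{-i(k\alpha+j\beta+l\gamma)}\,d(\alpha,\beta,\gamma)$$ be the Fourier coefficients of the double Fourier sphere (DFS) transform $f\circ R\colon\mathbb T^3\to\mathbb C$ of $f$. Then the following are equivalent: 1. $f$ is real-valued; 2. $\hat f_n^{k,l}=(-1)^{k+l}\,\overline{\hat f_n^{-k,-l}}$ for all $0\le n\le N$ and $|k|,|l|\le n$; 3. $\hat g_{k,j,l}=\overline{\hat g_{-k,-j,-l}}$ for all $k,j,l\in\{-N,\dots,N\}$;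 4. $c_{k,j,l}=\overline{c_{-k,-j,-l}}$ for all $k,j,l\in\{-N,\dots,N\}$. -/

import Mathlib

namespace WignerDFS

noncomputable section

/-- The rotation group, with the subspace topology of real `3 × 3` matrices. -/
abbrev SO3 : Type := ↥(Matrix.specialOrthogonalGroup (Fin 3) ℝ)

instance : IsTopologicalGroup SO3 where
  continuous_mul := by
    refine Continuous.subtype_mk ?_ _
    exact (continuous_subtype_val.comp continuous_fst).mul
      (continuous_subtype_val.comp continuous_snd)
  continuous_inv := by
    refine Continuous.subtype_mk ?_ _
    exact Continuous.matrix_conjTranspose continuous_subtype_val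

theorem abs_entry_le_one (R : SO3) (i j : Fin 3) : |R.1 i j| ≤ 1 := by
  have h := (Matrix.mem_orthogonalGroup_iff (Fin 3) ℝ).1
    (Matrix.mem_specialOrthogonalGroup_iff.1 R.2).1
  have h2 := congrFun (congrFun h i) i
  simp only [Matrix.mul_apply, Matrix.transpose_apply, Matrix.one_apply_eq] at h2
  have h3 : R.1 i j * R.1 i j ≤ ∑ m, R.1 i m * R.1 i m :=
    Finset.single_le_sum (f := fun m => R.1 i m * R.1 i m)
      (fun m _ => mul_self_nonneg _) (Finset.mem_univ j)
  rw [abs_le]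
  constructor <;> nlinarith

instance : CompactSpace SO3 := by
  apply isCompact_iff_compactSpace.1
  have hK : IsCompact (Set.univ.pi fun _ : Fin 3 => Set.univ.pi fun _ : Fin 3 =>
      Set.Icc (-1 : ℝ) 1) :=
    isCompact_univ_pi fun _ => isCompact_univ_pi fun _ => isCompact_Icc
  refine hK.of_isClosed_subset ?_ ?_
  · have : ((Matrix.specialOrthogonalGroup (Fin 3) ℝ : Set (Matrix (Fin 3) (Fin 3) ℝ))) =
        {A | A * A.transpose = 1} ∩ {A | A.det = 1} := by
      ext A
      simp only [SetLike.mem_coe, Matrix.mem_specialOrthogonalGroup_iff,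
        Matrix.mem_orthogonalGroup_iff, Set.mem_inter_iff, Set.mem_ofPred_eq]
    rw [this]
    refine IsClosed.inter (isClosed_eq ?_ continuous_const) (isClosed_eq ?_ continuous_const)
    · exact continuous_id.matrix_mul continuous_id.matrix_transpose
    · exact continuous_id.matrix_det
  · intro A hA
    simp only [Set.mem_univ_pi]
    intro i j
    exact abs_le.1 (abs_entry_le_one ⟨A, hA⟩ i j)

instance : MeasurableSpace SO3 := borel SO3

instance : BorelSpace SO3 := ⟨rfl⟩

/-- The Haar measure of `SO3`, normalized to total mass one. -/
def haar : MeasureTheory.Measure SO3 := MeasureTheory.Measure.haarMeasure ⊤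

/-- Rotation about the `z`-axis. -/
def rotZ (θ : Real.Angle) : SO3 :=
  ⟨!![θ.cos, -θ.sin, 0; θ.sin, θ.cos, 0; 0, 0, 1], by
    have h := Real.Angle.cos_sq_add_sin_sq θ
    rw [Matrix.mem_specialOrthogonalGroup_iff, Matrix.mem_orthogonalGroup_iff]
    constructor
    · ext i j
      fin_cases i <;> fin_cases j <;>
        simp [Matrix.mul_apply, Fin.sum_univ_three] <;> nlinarith
    · simp [Matrix.det_fin_three]
      nlinarith⟩

/-- Rotation about the `y`-axis. -/
def rotY (θ : Real.Angle) : SO3 :=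
  ⟨!![θ.cos, 0, θ.sin; 0, 1, 0; -θ.sin, 0, θ.cos], by
    have h := Real.Angle.cos_sq_add_sin_sq θ
    rw [Matrix.mem_specialOrthogonalGroup_iff, Matrix.mem_orthogonalGroup_iff]
    constructor
    · ext i j
      fin_cases i <;> fin_cases j <;>
        simp [Matrix.mul_apply, Fin.sum_univ_three] <;> nlinarith
    · simp [Matrix.det_fin_three]
      nlinarith⟩

/-- The Euler angle parametrization `R(α, β, γ) = R_z(α) R_y(β) R_z(γ)` of `SO3` by the
torus `(ℝ / 2πℤ)³`. -/
def euler (α β γ : Real.Angle) : SO3 := rotZ α * rotY β * rotZ γ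

theorem exists_polar (x y : ℝ) : ∃ α : ℝ,
    √(x ^ 2 + y ^ 2) * Real.cos α = x ∧ √(x ^ 2 + y ^ 2) * Real.sin α = y := by
  refine ⟨Complex.arg ⟨x, y⟩, ?_, ?_⟩
  · have h := Complex.norm_mul_cos_arg ⟨x, y⟩
    rwa [Complex.norm_eq_sqrt_sq_add_sq] at h
  · have h := Complex.norm_mul_sin_arg ⟨x, y⟩
    rwa [Complex.norm_eq_sqrt_sq_add_sq] at h

theorem col_orth (R : SO3) (i j : Fin 3) :
    R.1 0 i * R.1 0 j + R.1 1 i * R.1 1 j + R.1 2 i * R.1 2 j = if i = j then 1 else 0 := by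
  have h := (Matrix.mem_orthogonalGroup_iff' (Fin 3) ℝ).1
    (Matrix.mem_specialOrthogonalGroup_iff.1 R.2).1
  have h2 := congrFun (congrFun h i) j
  simpa only [Matrix.mul_apply, Matrix.transpose_apply, Matrix.one_apply,
    Fin.sum_univ_three] using h2

theorem exists_rotZ (M : SO3) (h0 : M.1 0 2 = 0) (h1 : M.1 1 2 = 0) (h2 : M.1 2 2 = 1) :
    ∃ γ : ℝ, M = rotZ γ := by
  have c02 := col_orth M 0 2
  have c12 := col_orth M 1 2
  have c00 := col_orth M 0 0
  have c01 := col_orth M 0 1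
  have c11 := col_orth M 1 1
  have hd := (Matrix.mem_specialOrthogonalGroup_iff.1 M.2).2
  rw [Matrix.det_fin_three] at hd
  simp only [h0, h1, h2] at c02 c12 hd
  have e20 : M.1 2 0 = 0 := by simpa using c02
  have e21 : M.1 2 1 = 0 := by simpa using c12
  simp only [e20, e21] at c00 c01 c11 hd
  simp at c00 c01 c11 hd
  obtain ⟨γ, hc, hs⟩ := exists_polar (M.1 0 0) (M.1 1 0)
  have h1' : M.1 0 0 ^ 2 + M.1 1 0 ^ 2 = 1 := by linarith [c00]
  rw [h1', Real.sqrt_one, one_mul] at hc hs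
  have e11 : M.1 1 1 = M.1 0 0 := by
    linear_combination M.1 0 0 * hd - M.1 1 1 * h1' + M.1 1 0 * c01
  have e01 : M.1 0 1 = - M.1 1 0 := by
    linear_combination - M.1 1 0 * hd - M.1 0 1 * h1' + M.1 0 0 * c01
  refine ⟨γ, ?_⟩
  ext i j
  fin_cases i <;> fin_cases j <;> simp [rotZ, hc, hs, h0, h1, h2, e20, e21, e11, e01]

/-- Every rotation has Euler angles with second angle in `[0, π]`. -/
theorem exists_euler (R : SO3) :
    ∃ α β γ : ℝ, β ∈ Set.Icc 0 Real.pi ∧ R = euler α β γ := by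
  obtain ⟨α, hc, hs⟩ := exists_polar (R.1 0 2) (R.1 1 2)
  have h22 := col_orth R 2 2
  rw [if_pos rfl] at h22
  have hz := abs_le.1 (abs_entry_le_one R 2 2)
  have hcos : Real.cos (Real.arccos (R.1 2 2)) = R.1 2 2 := Real.cos_arccos hz.1 hz.2
  have hsin : √(R.1 0 2 ^ 2 + R.1 1 2 ^ 2) = Real.sin (Real.arccos (R.1 2 2)) := by
    rw [Real.sin_arccos]
    congr 1
    linarith
  rw [hsin] at hc hs
  generalize hβ : Real.arccos (R.1 2 2) = β at *
  have hsc := Real.sin_sq_add_cos_sq α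
  have hscβ := Real.sin_sq_add_cos_sq β
  obtain ⟨γ, hγ⟩ := exists_rotZ ((rotY β)⁻¹ * ((rotZ α)⁻¹ * R))
    (by
      change ((star (rotY β).1) * (star (rotZ α).1 * R.1)) 0 2 = 0
      simp [Matrix.mul_apply, Fin.sum_univ_three, rotY, rotZ, Matrix.star_eq_conjTranspose]
      rw [← hc, ← hs, ← hcos]
      linear_combination Real.cos β * Real.sin β * hsc)
    (by
      change ((star (rotY β).1) * (star (rotZ α).1 * R.1)) 1 2 = 0
      simp [Matrix.mul_apply, Fin.sum_univ_three, rotY, rotZ, Matrix.star_eq_conjTranspose]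
      rw [← hc, ← hs]
      ring)
    (by
      change ((star (rotY β).1) * (star (rotZ α).1 * R.1)) 2 2 = 1
      simp [Matrix.mul_apply, Fin.sum_univ_three, rotY, rotZ, Matrix.star_eq_conjTranspose]
      rw [← hc, ← hs, ← hcos]
      linear_combination Real.sin β ^ 2 * hsc + hscβ)
  refine ⟨α, β, γ, ?_, ?_⟩
  · rw [← hβ]
    exact ⟨Real.arccos_nonneg _, Real.arccos_le_pi _⟩
  · rw [euler, ← hγ]
    group

/-- The Jacobi polynomial `P_s^{(a,b)}` for integer parameters `a, b ≥ 0`. -/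
def jacobi (s a b : ℕ) (x : ℝ) : ℝ :=
  ∑ m ∈ Finset.range (s + 1), ((s + a).choose (s - m) : ℝ) * ((s + b).choose m : ℝ) *
    ((x - 1) / 2) ^ m * ((x + 1) / 2) ^ (s - m)

/-- The Wigner-d function `d_n^{k,l}`, for `|k|, |l| ≤ n` and `x ∈ [-1, 1]`: with `a = |k - l|`,
`b = |k + l|`, `s = n - max (|k|, |l|)` and `ν = k + l` if `k > l`, `ν = 0` otherwise, it is
`(-1)^ν * C(2n-s, s+a)^(1/2) * C(s+b, b)^(-1/2) * ((1-x)/2)^(a/2) * ((1+x)/2)^(b/2) * P_s^{(a,b)}(x)`. -/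
def wignerSmallD (n : ℕ) (k l : ℤ) (x : ℝ) : ℝ :=
  let a : ℕ := (k - l).natAbs
  let b : ℕ := (k + l).natAbs
  let s : ℕ := n - max k.natAbs l.natAbs
  (if l < k then (-1 : ℝ) ^ (k + l) else 1) *
    √((2 * n - s).choose (s + a) : ℝ) * (√((s + b).choose b : ℝ))⁻¹ *
    √((1 - x) / 2) ^ a * √((1 + x) / 2) ^ b * jacobi s a b x

/-- The expression of the Wigner-D function `D_n^{k,l}` in Euler angles,
`√(2n+1) e^{-ikα} d_n^{k,l}(cos β) e^{-ilγ}`. -/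
def wignerDEuler (n : ℕ) (k l : ℤ) (α β γ : ℝ) : ℂ :=
  (√(2 * n + 1 : ℝ) : ℂ) * Complex.exp (-(Complex.I * k * α)) *
    (wignerSmallD n k l (Real.cos β) : ℂ) * Complex.exp (-(Complex.I * l * γ))

/-- The `L²`-normalized Wigner-D function `D_n^{k,l} : SO3 → ℂ`. The value does not depend on the
choice of Euler angles with second angle in `[0, π]`, see `wignerD_euler`. -/
def wignerD (n : ℕ) (k l : ℤ) (R : SO3) : ℂ :=
  wignerDEuler n k l (exists_euler R).choose (exists_euler R).choose_spec.choose
    (exists_euler R).choose_spec.choose_spec.choose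

theorem exp_int_congr (k : ℤ) {x y : ℝ} (hc : Real.cos x = Real.cos y)
    (hs : Real.sin x = Real.sin y) :
    Complex.exp (-(Complex.I * k * x)) = Complex.exp (-(Complex.I * k * y)) := by
  have h : ∀ z : ℝ, Complex.exp (-(Complex.I * k * z)) =
      (((Real.cos z : ℝ) : ℂ) + ((Real.sin z : ℝ) : ℂ) * Complex.I) ^ (-k) := by
    intro z
    rw [Complex.ofReal_cos, Complex.ofReal_sin, ← Complex.exp_mul_I, ← Complex.exp_int_mul]
    congr 1
    push_cast
    ring
  rw [h, h, hc, hs]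

theorem wignerSmallD_one (n : ℕ) {k l : ℤ} (h : k ≠ l) : wignerSmallD n k l 1 = 0 := by
  have : (k - l).natAbs ≠ 0 := by omega
  simp [wignerSmallD, this]

theorem wignerSmallD_neg_one (n : ℕ) {k l : ℤ} (h : k + l ≠ 0) :
    wignerSmallD n k l (-1) = 0 := by
  have : (k + l).natAbs ≠ 0 := by omega
  simp [wignerSmallD, this]

theorem wignerDEuler_congr (n : ℕ) (k l : ℤ) {α β γ α' β' γ' : ℝ}
    (hβ : β ∈ Set.Icc 0 Real.pi) (hβ' : β' ∈ Set.Icc 0 Real.pi)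
    (h : euler α β γ = euler α' β' γ') :
    wignerDEuler n k l α β γ = wignerDEuler n k l α' β' γ' := by
  have hij : ∀ i j : Fin 3, (euler α β γ).1 i j = (euler α' β' γ').1 i j := by
    intro i j
    rw [h]
  have h22 := hij 2 2
  have h02 := hij 0 2
  have h12 := hij 1 2
  have h20 := hij 2 0
  have h21 := hij 2 1
  have h00 := hij 0 0
  have h10 := hij 1 0
  simp [euler, rotZ, rotY] at h22 h02 h12 h20 h21 h00 h10
  obtain rfl : β = β' := Real.injOn_cos hβ hβ' h22
  by_cases hs : Real.sin β = 0
  · have hcs : Real.cos β = 1 ∨ Real.cos β = -1 := by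
      have := Real.sin_sq_add_cos_sq β
      rw [hs] at this
      exact mul_self_eq_one_iff.1 (by linarith)
    rcases hcs with hc | hc
    · by_cases hkl : k = l
      · subst hkl
        have key := exp_int_congr k (x := α + γ) (y := α' + γ')
          (by rw [Real.cos_add, Real.cos_add]; rw [hc] at h00; linarith)
          (by rw [Real.sin_add, Real.sin_add]; rw [hc] at h10; linarith)
        have e : ∀ u v : ℝ, wignerDEuler n k k u β v = (√(2 * n + 1 : ℝ) : ℂ) *
            (wignerSmallD n k k (Real.cos β) : ℂ) *
              Complex.exp (-(Complex.I * k * ((u + v : ℝ) : ℂ))) := by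
          intro u v
          have : -(Complex.I * k * ((u + v : ℝ) : ℂ)) =
              -(Complex.I * k * u) + -(Complex.I * k * v) := by
            push_cast
            ring
          rw [this, Complex.exp_add, wignerDEuler]
          ring
        rw [e, e, key]
      · simp [wignerDEuler, hc, wignerSmallD_one n hkl]
    · by_cases hkl : k + l = 0
      · obtain rfl : l = -k := by omega
        have key := exp_int_congr k (x := α - γ) (y := α' - γ')
          (by rw [Real.cos_sub, Real.cos_sub]; rw [hc] at h00; linarith)
          (by rw [Real.sin_sub, Real.sin_sub]; rw [hc] at h10; linarith)
        have e : ∀ u v : ℝ, wignerDEuler n k (-k) u β v = (√(2 * n + 1 : ℝ) : ℂ) *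
            (wignerSmallD n k (-k) (Real.cos β) : ℂ) *
              Complex.exp (-(Complex.I * k * ((u - v : ℝ) : ℂ))) := by
          intro u v
          have : -(Complex.I * k * ((u - v : ℝ) : ℂ)) =
              -(Complex.I * k * u) + -(Complex.I * ((-k : ℤ) : ℂ) * v) := by
            push_cast
            ring
          rw [this, Complex.exp_add, wignerDEuler]
          ring
        rw [e, e, key]
      · simp [wignerDEuler, hc, wignerSmallD_neg_one n hkl]
  · have hα := exp_int_congr k (x := α) (y := α')
      (mul_right_cancel₀ hs (by simp_all)) (mul_right_cancel₀ hs (by simp_all))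
    have hγ := exp_int_congr l (x := γ) (y := γ')
      (mul_left_cancel₀ hs (by simp_all)) (mul_left_cancel₀ hs (by simp_all))
    rw [wignerDEuler, wignerDEuler, hα, hγ]

theorem wignerD_euler (n : ℕ) (k l : ℤ) (α β γ : ℝ) (hβ : β ∈ Set.Icc 0 Real.pi) :
    wignerD n k l (euler α β γ) = wignerDEuler n k l α β γ := by
  have h := (exists_euler (euler α β γ)).choose_spec.choose_spec.choose_spec
  exact wignerDEuler_congr n k l h.1 hβ h.2.symm

/-- The harmonic space of degree `n`: the span of the `D_n^{k,l}`, `|k|, |l| ≤ n`. -/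
def harm (n : ℕ) : Submodule ℂ (SO3 → ℂ) :=
  Submodule.span ℂ {D | ∃ k l : ℤ, |k| ≤ n ∧ |l| ≤ n ∧ D = wignerD n k l}

/-- The space of `N`-band-limited functions: the sum of the harmonic spaces of degree at
most `N`. -/
def bandLimited (N : ℕ) : Submodule ℂ (SO3 → ℂ) :=
  ⨆ n ∈ Finset.range (N + 1), harm n

/-- The inner product `⟨f, g⟩ = ∫ f conj(g) dμ` of `L²(SO3)`. -/
def innerL2 (f g : SO3 → ℂ) : ℂ := ∫ R, f R * starRingEnd ℂ (g R) ∂haar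

/-- The harmonic coefficients `⟨f, D_n^{k,l}⟩` of `f`. -/
def harmonicCoeff (f : SO3 → ℂ) (n : ℕ) (k l : ℤ) : ℂ := innerL2 f (wignerD n k l)

/-- The Wigner transform `W_N`, which maps harmonic coefficients to Fourier coefficients. -/
def wignerTransform (N : ℕ) (c : ℕ → ℤ → ℤ → ℂ) (k j l : ℤ) : ℂ :=
  Complex.I ^ (k - l) *
    ∑ n ∈ Finset.Icc (max (max k.natAbs l.natAbs) j.natAbs) N,
      (√(2 * n + 1 : ℝ) : ℂ) * (wignerSmallD n j k 0 : ℂ) * (wignerSmallD n j l 0 : ℂ) *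
        c n (-k) (-l)

/-- The DFS transform `g = f ∘ R` of `f`, a function on the torus `(ℝ / 2πℤ)³`. -/
def dfsTransform (f : SO3 → ℂ) (α β γ : Real.Angle) : ℂ := f (euler α β γ)

/-- The Fourier coefficients of a function on the torus `(ℝ / 2πℤ)³`, normalized such that
`g = ∑ ĝ_{k,j,l} e^{i(kα + jβ + lγ)}`. -/
def fourierCoeffTorus (g : Real.Angle → Real.Angle → Real.Angle → ℂ) (k j l : ℤ) : ℂ :=
  (1 / (2 * Real.pi) ^ 3 : ℂ) *
    ∫ α in (0 : ℝ)..(2 * Real.pi), ∫ β in (0 : ℝ)..(2 * Real.pi), ∫ γ in (0 : ℝ)..(2 * Real.pi),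
      g α β γ * Complex.exp (-(Complex.I * (k * α + j * β + l * γ)))

end

end WignerDFS

namespace WignerDFS

/-! All four conditions say that `f` equals its complex conjugate. The space of band-limited
functions is closed under conjugation, because conjugating a Wigner-D function negates both orders
up to the sign `(-1)^(k+l)` (`star_wignerD`, `star_mem_bandLimited`). Under conjugation of `f`, each
of the three families of numbers undergoes exactly the involution in the corresponding symmetry
condition (`harmonicCoeff_star`, `wignerTransform_star`, `fourierCoeffTorus_star`). Hence conditions
2, 3 and 4 say that `f` and its conjugate have the same data.

It remains that each kind of data determines a band-limited function. For harmonic coefficients, a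
band-limited function orthogonal to every spanning function is orthogonal to itself; orthonormality
of the Wigner-D functions is not needed. The Wigner transform is triangular in the degree with
nonzero diagonal, so it determines the harmonic coefficients. For Fourier coefficients, the DFS
transform is a trigonometric polynomial with frequencies in the cube, and Euler angles cover the
whole group. The identity between the Wigner transform and the Fourier coefficients plays no role.
-/

theorem neg_one_zpow_mul_self (m : ℤ) : (-1 : ℂ) ^ m * (-1 : ℂ) ^ m = 1 := by
  rw [← mul_zpow]; simp

/-! ### Conjugation symmetry of the Wigner functions -/

theorem wignerSmallD_neg_neg (n : ℕ) (k l : ℤ) (x : ℝ) :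
    wignerSmallD n (-k) (-l) x = (-1 : ℝ) ^ (k + l) * wignerSmallD n k l x := by
  have ha : (-k - -l).natAbs = (k - l).natAbs := by omega
  have hb : (-k + -l).natAbs = (k + l).natAbs := by omega
  -- Only the sign prefactor sees the negation: the factor `(-1)^(k+l)` moves from the case `l < k`
  -- to the case `k < l`, and for `k = l` it is `1`.
  have hs : (if -l < -k then (-1 : ℝ) ^ (-k + -l) else 1) =
      (-1 : ℝ) ^ (k + l) * (if l < k then (-1 : ℝ) ^ (k + l) else 1) := by
    have h1 : (-1 : ℝ) ^ (k + l) * (-1 : ℝ) ^ (k + l) = 1 := by rw [← mul_zpow]; simp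
    rcases lt_trichotomy k l with h | h | h
    · rw [if_pos (by omega), if_neg (by omega), mul_one, ← neg_add, zpow_neg]
      exact (eq_inv_of_mul_eq_one_left h1).symm
    · subst h
      simp [← two_mul, zpow_mul]
    · rw [if_neg (by omega), if_pos h, h1]
  simp only [wignerSmallD, ha, hb, hs, Int.natAbs_neg]
  ring

theorem star_wignerD (n : ℕ) (k l : ℤ) (R : SO3) :
    starRingEnd ℂ (wignerD n k l R) = (-1 : ℂ) ^ (k + l) * wignerD n (-k) (-l) R := by
  -- The chosen Euler angles depend on `R` alone, so both sides are evaluated at the same angles.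
  rw [wignerD, wignerD, wignerDEuler, wignerDEuler, wignerSmallD_neg_neg]
  simp only [map_mul, ← Complex.exp_conj, map_neg, Complex.conj_ofReal, Complex.conj_I,
    map_intCast]
  push_cast
  simp only [neg_mul, mul_neg]
  have key : ∀ A B C D : ℂ, A * B * C * D =
      (-1) ^ (k + l) * (A * B * ((-1) ^ (k + l) * C) * D) := fun A B C D => by
    linear_combination (-(A * B * C * D)) * neg_one_zpow_mul_self (k + l)
  exact key _ _ _ _

/-! ### Continuity of the Wigner functions -/

theorem continuous_rotZ : Continuous fun θ : ℝ => rotZ θ := by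
  refine Continuous.subtype_mk ?_ _
  refine continuous_matrix fun i j => ?_
  fin_cases i <;> fin_cases j <;> simp <;> fun_prop

theorem continuous_rotY : Continuous fun θ : ℝ => rotY θ := by
  refine Continuous.subtype_mk ?_ _
  refine continuous_matrix fun i j => ?_
  fin_cases i <;> fin_cases j <;> simp <;> fun_prop

theorem continuous_euler : Continuous fun p : ℝ × ℝ × ℝ => euler p.1 p.2.1 p.2.2 :=
  ((continuous_rotZ.comp continuous_fst).mul
    (continuous_rotY.comp (continuous_fst.comp continuous_snd))).mul
    (continuous_rotZ.comp (continuous_snd.comp continuous_snd))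

theorem continuous_wignerSmallD (n : ℕ) (k l : ℤ) : Continuous (wignerSmallD n k l) := by
  unfold wignerSmallD jacobi
  fun_prop

/-- The definition goes through a non-continuous choice of Euler angles. However, the Euler map from
a compact box onto the Hausdorff group is a quotient map, and the pullback to the box is an explicit
continuous expression. -/
theorem continuous_wignerD (n : ℕ) (k l : ℤ) : Continuous (wignerD n k l) := by
  let K : Set (ℝ × ℝ × ℝ) :=
    Set.Icc (-Real.pi) Real.pi ×ˢ Set.Icc 0 Real.pi ×ˢ Set.Icc (-Real.pi) Real.pi
  have hK : CompactSpace K :=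
    isCompact_iff_compactSpace.1 (isCompact_Icc.prod (isCompact_Icc.prod isCompact_Icc))
  let F : K → SO3 := fun p => euler p.1.1 p.1.2.1 p.1.2.2
  have hF : Continuous F := continuous_euler.comp continuous_subtype_val
  have hsurj : Function.Surjective F := by
    intro R
    obtain ⟨α, β, γ, hβ, rfl⟩ := exists_euler R
    have h : ∀ x : Real.Angle, x.toReal ∈ Set.Icc (-Real.pi) Real.pi := fun x =>
      ⟨(Real.Angle.neg_pi_lt_toReal x).le, Real.Angle.toReal_le_pi x⟩
    refine ⟨⟨((α : Real.Angle).toReal, β, (γ : Real.Angle).toReal), h α, hβ, h γ⟩, ?_⟩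
    simp [F]
  have hq := (hF.isClosedMap.isQuotientMap hF hsurj)
  rw [hq.continuous_iff]
  have : wignerD n k l ∘ F = fun p : K => wignerDEuler n k l p.1.1 p.1.2.1 p.1.2.2 := by
    funext p
    exact wignerD_euler n k l _ _ _ p.2.2.1
  rw [this]
  have := continuous_wignerSmallD n k l
  unfold wignerDEuler
  fun_prop

/-! ### Band-limited functions and their harmonic coefficients -/

theorem bandLimited_le {N : ℕ} {p : Submodule ℂ (SO3 → ℂ)}
    (h : ∀ (n : ℕ) (k l : ℤ), n ≤ N → |k| ≤ n → |l| ≤ n → wignerD n k l ∈ p) :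
    bandLimited N ≤ p := by
  refine iSup₂_le fun n hn => Submodule.span_le.2 ?_
  rintro _ ⟨k, l, hk, hl, rfl⟩
  exact h n k l (by simpa [Nat.lt_succ_iff] using hn) hk hl

theorem wignerD_mem_bandLimited {N n : ℕ} {k l : ℤ} (hn : n ≤ N) (hk : |k| ≤ n)
    (hl : |l| ≤ n) : wignerD n k l ∈ bandLimited N :=
  Submodule.mem_iSup_of_mem n <| Submodule.mem_iSup_of_mem (by simpa [Nat.lt_succ_iff] using hn) <|
    Submodule.subset_span ⟨k, l, hk, hl, rfl⟩

theorem continuous_of_mem_bandLimited {N : ℕ} {f : SO3 → ℂ} (hf : f ∈ bandLimited N) :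
    Continuous f := by
  have h : bandLimited N ≤ ({
      carrier := {g | Continuous g}
      add_mem' := fun ha hb => Continuous.add ha hb
      zero_mem' := continuous_const
      smul_mem' := fun c _ hg => Continuous.const_smul hg c } : Submodule ℂ (SO3 → ℂ)) :=
    bandLimited_le fun n k l _ _ _ => continuous_wignerD n k l
  exact h hf

theorem star_mem_bandLimited {N : ℕ} {f : SO3 → ℂ} (hf : f ∈ bandLimited N) :
    (fun R => starRingEnd ℂ (f R)) ∈ bandLimited N := by
  have h : bandLimited N ≤ ({
      carrier := {g | (fun R => starRingEnd ℂ (g R)) ∈ bandLimited N}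
      add_mem' := fun {a b} ha hb => by
        simp only [Set.mem_ofPred_eq, Pi.add_apply, map_add] at *
        exact Submodule.add_mem _ ha hb
      zero_mem' := by
        simp only [Set.mem_ofPred_eq, Pi.zero_apply, map_zero]
        exact Submodule.zero_mem (bandLimited N)
      smul_mem' := fun c g hg => by
        simp only [Set.mem_ofPred_eq, Pi.smul_apply, smul_eq_mul, map_mul] at *
        exact Submodule.smul_mem _ (starRingEnd ℂ c) hg } : Submodule ℂ (SO3 → ℂ)) := by
    refine bandLimited_le fun n k l hn hk hl => ?_
    have : (fun R => starRingEnd ℂ (wignerD n k l R)) =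
        ((-1 : ℂ) ^ (k + l)) • wignerD n (-k) (-l) := by
      funext R
      simp [star_wignerD]
    change _ ∈ bandLimited N
    rw [this]
    exact Submodule.smul_mem _ _ (wignerD_mem_bandLimited hn (by simpa) (by simpa))
  exact h hf

instance : MeasureTheory.IsFiniteMeasure haar := by
  unfold haar; infer_instance

instance : haar.IsOpenPosMeasure := by
  unfold haar; infer_instance

theorem integrable_haar {g : SO3 → ℂ} (hg : Continuous g) : MeasureTheory.Integrable g haar :=
  hg.integrable_of_hasCompactSupport (HasCompactSupport.of_compactSpace g)

/-- Orthogonality to the spanning functions extends to the whole span, hence to `h` itself. Then `∫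
|h|² = 0`, and a continuous function vanishing almost everywhere is zero because Haar measure
charges open sets. -/
theorem eq_zero_of_harmonicCoeff_eq_zero {N : ℕ} {h : SO3 → ℂ} (hh : h ∈ bandLimited N)
    (h0 : ∀ (n : ℕ) (k l : ℤ), n ≤ N → |k| ≤ n → |l| ≤ n → harmonicCoeff h n k l = 0) :
    h = 0 := by
  have hc := continuous_of_mem_bandLimited hh
  -- Continuity is carried along because additivity of the integral needs integrability.
  have key : bandLimited N ≤ ({
      carrier := {g | Continuous g ∧ innerL2 h g = 0}
      add_mem' := fun {a b} ha hb => by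
        refine ⟨ha.1.add hb.1, ?_⟩
        have h1 := ha.1
        have h2 := hb.1
        have := ha.2
        have := hb.2
        simp only [innerL2, Pi.add_apply, map_add, mul_add] at *
        rw [MeasureTheory.integral_add (integrable_haar (by fun_prop))
          (integrable_haar (by fun_prop))]
        simp_all
      zero_mem' := ⟨continuous_const, by simp [innerL2]⟩
      smul_mem' := fun c g hg => by
        refine ⟨hg.1.const_smul c, ?_⟩
        have := hg.2
        simp only [innerL2, Pi.smul_apply, smul_eq_mul, map_mul, mul_left_comm _ (starRingEnd ℂ c),
          MeasureTheory.integral_const_mul] at *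
        rw [this, mul_zero] } : Submodule ℂ (SO3 → ℂ)) :=
    bandLimited_le fun n k l hn hk hl => ⟨continuous_wignerD n k l, h0 n k l hn hk hl⟩
  have hz : innerL2 h h = 0 := (key hh).2
  have hz' : ∫ R, Complex.normSq (h R) ∂haar = 0 := by
    simp only [innerL2, Complex.mul_conj] at hz
    rw [integral_complex_ofReal] at hz
    exact_mod_cast hz
  have hcn : Continuous fun R => Complex.normSq (h R) := Complex.continuous_normSq.comp hc
  have hae := (MeasureTheory.integral_eq_zero_iff_of_nonneg (fun R => Complex.normSq_nonneg (h R))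
    (hcn.integrable_of_hasCompactSupport (HasCompactSupport.of_compactSpace _))).1 hz'
  have := hcn.ae_eq_iff_eq haar continuous_const |>.1 hae
  funext R
  exact Complex.normSq_eq_zero.1 (congrFun this R)

theorem harmonicCoeff_star (f : SO3 → ℂ) (n : ℕ) (k l : ℤ) :
    harmonicCoeff (fun R => starRingEnd ℂ (f R)) n k l =
      (-1 : ℂ) ^ (k + l) * starRingEnd ℂ (harmonicCoeff f n (-k) (-l)) := by
  have h : ∀ R, starRingEnd ℂ (f R) * starRingEnd ℂ (wignerD n k l R) =
      (-1 : ℂ) ^ (k + l) * starRingEnd ℂ (f R * starRingEnd ℂ (wignerD n (-k) (-l) R)) := by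
    intro R
    rw [star_wignerD n k l, map_mul, Complex.conj_conj]
    ring
  simp only [harmonicCoeff, innerL2, h, MeasureTheory.integral_const_mul, integral_conj]

/-- When the first order equals the degree, `s = 0`: the Jacobi factor is the constant `1`, and no
other factor vanishes at `0`. -/
theorem wignerSmallD_self_left_ne_zero {n : ℕ} {k : ℤ} (hk : |k| ≤ n) :
    wignerSmallD n n k 0 ≠ 0 := by
  have hs : n - max (n : ℤ).natAbs k.natAbs = 0 := by
    simp
  have ha : ((n : ℤ) - k).natAbs ≤ 2 * n := by
    rw [abs_le] at hk; omega
  have h1 : (0 : ℝ) < ((2 * n).choose ((n : ℤ) - k).natAbs : ℝ) := by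
    exact_mod_cast Nat.choose_pos ha
  have h2 : (if k < n then (-1 : ℝ) ^ (n + k) else 1) ≠ 0 := by
    split_ifs
    · exact zpow_ne_zero _ (by norm_num)
    · exact one_ne_zero
  simp only [wignerSmallD, hs, jacobi]
  refine mul_ne_zero (mul_ne_zero (mul_ne_zero (mul_ne_zero (mul_ne_zero h2 ?_) ?_) ?_) ?_) ?_
  · simpa using (Real.sqrt_pos.2 h1).ne'
  all_goals simp

/-! ### Fourier coefficients of trigonometric polynomials -/

/-- The exponential `e^{imx}`. -/
noncomputable def expI (m : ℤ) (x : ℝ) : ℂ := Complex.exp (Complex.I * m * x)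

theorem expI_eq_zpow (m : ℤ) (x : ℝ) : expI m x = Complex.exp (Complex.I * x) ^ m := by
  rw [expI, ← Complex.exp_int_mul]
  congr 1
  ring

theorem expI_add (m m' : ℤ) (x : ℝ) : expI (m + m') x = expI m x * expI m' x := by
  rw [expI_eq_zpow, expI_eq_zpow, expI_eq_zpow, zpow_add₀ (Complex.exp_ne_zero _)]

theorem conj_expI (m : ℤ) (x : ℝ) : starRingEnd ℂ (expI m x) = expI (-m) x := by
  rw [expI, expI, ← Complex.exp_conj]
  congr 1
  simp

theorem continuous_expI (m : ℤ) : Continuous (expI m) := by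
  unfold expI; fun_prop

theorem integral_expI (m : ℤ) :
    ∫ x in (0 : ℝ)..(2 * Real.pi), expI m x = if m = 0 then (2 * Real.pi : ℂ) else 0 := by
  split_ifs with h
  · subst h
    simp [expI]
  · have hm : Complex.I * m ≠ 0 := mul_ne_zero Complex.I_ne_zero (by exact_mod_cast h)
    simp only [expI]
    rw [integral_exp_mul_complex hm]
    have : Complex.exp (Complex.I * m * ((2 * Real.pi : ℝ) : ℂ)) = 1 := by
      rw [Complex.exp_eq_one_iff]
      exact ⟨m, by push_cast; ring⟩
    rw [this]
    simp

theorem integral_sum_expI {ι : Type*} (S : Finset ι) (c : ι → ℂ) (m : ι → ℤ) :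
    ∫ x in (0 : ℝ)..(2 * Real.pi), ∑ i ∈ S, c i * expI (m i) x =
      ∑ i ∈ S, c i * if m i = 0 then (2 * Real.pi : ℂ) else 0 := by
  rw [intervalIntegral.integral_finsetSum]
  · simp only [intervalIntegral.integral_const_mul, integral_expI]
  · intro i _
    exact ((continuous_expI _).const_mul (c i)).intervalIntegrable _ _

/-- Fourier coefficients of a trigonometric polynomial on the torus. -/
theorem fourierCoeffTorus_sum {g : Real.Angle → Real.Angle → Real.Angle → ℂ}
    (S : Finset (ℤ × ℤ × ℤ)) (c : ℤ × ℤ × ℤ → ℂ)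
    (hg : ∀ α β γ : ℝ, g α β γ =
      ∑ p ∈ S, c p * expI p.1 α * expI p.2.1 β * expI p.2.2 γ) (k j l : ℤ) :
    fourierCoeffTorus g k j l = if (k, j, l) ∈ S then c (k, j, l) else 0 := by
  have h1 : ∀ α β γ : ℝ, g α β γ * Complex.exp (-(Complex.I * (k * α + j * β + l * γ))) =
      ∑ p ∈ S, (c p * expI (p.1 - k) α * expI (p.2.1 - j) β) * expI (p.2.2 - l) γ := by
    intro α β γ
    have : Complex.exp (-(Complex.I * (k * α + j * β + l * γ))) =
        expI (-k) α * expI (-j) β * expI (-l) γ := by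
      simp only [expI, ← Complex.exp_add]
      congr 1
      push_cast
      ring
    rw [hg, this, Finset.sum_mul]
    refine Finset.sum_congr rfl fun p _ => ?_
    simp only [sub_eq_add_neg, expI_add]
    ring
  -- Reorderings that put the exponential of the next integration variable last, the shape
  -- `integral_sum_expI` expects.
  have h2 : ∀ (α β : ℝ) (t : ℤ × ℤ × ℤ → ℂ),
      ∑ p ∈ S, c p * expI (p.1 - k) α * expI (p.2.1 - j) β * t p =
        ∑ p ∈ S, (c p * expI (p.1 - k) α * t p) * expI (p.2.1 - j) β :=
    fun _ _ _ => Finset.sum_congr rfl fun _ _ => by ring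
  have h3 : ∀ (α : ℝ) (t u : ℤ × ℤ × ℤ → ℂ),
      ∑ p ∈ S, c p * expI (p.1 - k) α * t p * u p =
        ∑ p ∈ S, (c p * t p * u p) * expI (p.1 - k) α :=
    fun _ _ _ => Finset.sum_congr rfl fun _ _ => by ring
  simp_rw [fourierCoeffTorus, h1, integral_sum_expI, h2, integral_sum_expI, h3, integral_sum_expI]
  have hpi : (2 * Real.pi : ℂ) ≠ 0 := by
    exact_mod_cast Real.two_pi_pos.ne'
  rw [Finset.mul_sum, ← Finset.sum_ite_eq' S (k, j, l) c]
  refine Finset.sum_congr rfl ?_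
  rintro ⟨k', j', l'⟩ _
  simp only [sub_eq_zero, Prod.mk.injEq]
  by_cases hk : k' = k <;> by_cases hj : j' = j <;> by_cases hl : l' = l <;>
    simp [hk, hj, hl]
  field_simp

/-! ### Trigonometric polynomials in half angles -/

/-- Trigonometric polynomials of degree at most `n`. -/
def trigPoly (n : ℕ) : Submodule ℂ (ℝ → ℂ) :=
  Submodule.span ℂ (expI '' {m | |m| ≤ n})

theorem zpow_neg_mul_eval_mem_trigPoly {n : ℕ} {P : Polynomial ℂ} (hP : P.natDegree ≤ 2 * n) :
    (fun x : ℝ => expI (-n) x * P.eval (expI 1 x)) ∈ trigPoly n := by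
  have : (fun x : ℝ => expI (-n) x * P.eval (expI 1 x)) =
      ∑ i ∈ Finset.range (2 * n + 1), P.coeff i • expI (i - n) := by
    funext x
    rw [Polynomial.eval_eq_sum_range' (Nat.lt_succ_of_le hP), Finset.mul_sum, Finset.sum_apply]
    refine Finset.sum_congr rfl fun i _ => ?_
    have : expI (i - n) x = expI (-n) x * expI 1 x ^ i := by
      rw [sub_eq_add_neg, add_comm, expI_add]
      simp [expI_eq_zpow]
    rw [Pi.smul_apply, smul_eq_mul, this]
    ring
  rw [this]
  refine Submodule.sum_mem _ fun i hi => Submodule.smul_mem _ _ (Submodule.subset_span ⟨_, ?_, rfl⟩)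
  rw [Finset.mem_range] at hi
  rw [Set.mem_ofPred_eq, abs_le]
  omega

/-- With `u = e^{ix/2}`, sine and cosine of `x/2` are `(u² - 1)/(2iu)` and `(u² + 1)/(2u)`. As the
total degree is `2n`, the denominators combine to `u^(2n) = e^{inx}`, leaving a polynomial of degree
at most `2n` in `e^{ix}`. -/
theorem sin_pow_mul_cos_pow_mem_trigPoly {n p q : ℕ} (h : p + q = 2 * n) :
    (fun x : ℝ => ((Real.sin (x / 2) ^ p * Real.cos (x / 2) ^ q : ℝ) : ℂ)) ∈ trigPoly n := by
  let P : Polynomial ℂ := Polynomial.C ((1 / (2 * Complex.I)) ^ p * (1 / 2) ^ q) *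
    ((Polynomial.X - 1) ^ p * (Polynomial.X + 1) ^ q)
  have hP : P.natDegree ≤ 2 * n := by
    rw [← h]
    refine (Polynomial.natDegree_C_mul_le _ _).trans (Polynomial.natDegree_mul_le_of_le ?_ ?_)
    · simpa using Polynomial.natDegree_pow_le_of_le p
        (Polynomial.natDegree_X_sub_C_le (1 : ℂ))
    · simpa using Polynomial.natDegree_pow_le_of_le q
        (Polynomial.natDegree_X_add_C (1 : ℂ)).le
  convert zpow_neg_mul_eval_mem_trigPoly hP using 2 with x
  set u : ℂ := Complex.exp (Complex.I * (x / 2 : ℝ)) with hu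
  have hu0 : u ≠ 0 := Complex.exp_ne_zero _
  have hw : expI 1 x = u ^ 2 := by
    rw [expI, hu, ← Complex.exp_nat_mul]
    congr 1
    push_cast
    ring
  have hn : expI (-n) x = (u ^ p * u ^ q)⁻¹ := by
    rw [← pow_add, h, pow_mul, ← hw, expI_eq_zpow, expI_eq_zpow]
    simp
  have hs : ((Real.sin (x / 2) : ℝ) : ℂ) = 1 / (2 * Complex.I) * (u ^ 2 - 1) / u := by
    have e : Complex.exp (-((x / 2 : ℝ) : ℂ) * Complex.I) = u⁻¹ := by
      rw [hu, ← Complex.exp_neg]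
      congr 1
      ring
    have e' : Complex.exp (((x / 2 : ℝ) : ℂ) * Complex.I) = u := by rw [hu, mul_comm]
    rw [Complex.ofReal_sin, Complex.sin, e, e']
    field_simp
    simp
  have hc : ((Real.cos (x / 2) : ℝ) : ℂ) = 1 / 2 * (u ^ 2 + 1) / u := by
    have e : Complex.exp (-((x / 2 : ℝ) : ℂ) * Complex.I) = u⁻¹ := by
      rw [hu, ← Complex.exp_neg]
      congr 1
      ring
    have e' : Complex.exp (((x / 2 : ℝ) : ℂ) * Complex.I) = u := by rw [hu, mul_comm]
    rw [Complex.ofReal_cos, Complex.cos, e, e']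
    field_simp
  rw [Complex.ofReal_mul, Complex.ofReal_pow, Complex.ofReal_pow, hs, hc, hn, hw]
  simp only [P, Polynomial.eval_mul, Polynomial.eval_C, Polynomial.eval_pow, Polynomial.eval_sub,
    Polynomial.eval_add, Polynomial.eval_X, Polynomial.eval_one, div_pow, mul_pow, mul_inv]
  ring

/-! ### Wigner functions at arbitrary Euler angles -/

/-- The Wigner-d function at `cos β`, as a polynomial in `sin (β / 2)` and `cos (β / 2)`. -/
noncomputable def wignerTrig (n : ℕ) (k l : ℤ) (β : ℝ) : ℝ :=
  let a : ℕ := (k - l).natAbs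
  let b : ℕ := (k + l).natAbs
  let s : ℕ := n - max k.natAbs l.natAbs
  (if l < k then (-1 : ℝ) ^ (k + l) else 1) *
    √((2 * n - s).choose (s + a) : ℝ) * (√((s + b).choose b : ℝ))⁻¹ *
    Real.sin (β / 2) ^ a * Real.cos (β / 2) ^ b * jacobi s a b (Real.cos β)

theorem sqrt_half_sub_cos (β : ℝ) : √((1 - Real.cos β) / 2) = |Real.sin (β / 2)| := by
  rw [← Real.sqrt_sq_eq_abs, Real.sin_sq_eq_half_sub]
  congr 1
  rw [mul_div_cancel₀ _ two_ne_zero]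
  ring

theorem sqrt_half_add_cos (β : ℝ) : √((1 + Real.cos β) / 2) = |Real.cos (β / 2)| := by
  rw [← Real.sqrt_sq_eq_abs, Real.cos_sq]
  congr 1
  rw [mul_div_cancel₀ _ two_ne_zero]
  ring

/-- Half-angle sine and cosine both acquire the sign `(-1)^m`; these cancel because `|k - l| + |k +
l|` is even. -/
theorem wignerTrig_add_int_mul_two_pi (n : ℕ) (k l m : ℤ) (β : ℝ) :
    wignerTrig n k l (β + m * (2 * Real.pi)) = wignerTrig n k l β := by
  have e : (β + m * (2 * Real.pi)) / 2 = β / 2 + m * Real.pi := by ring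
  have hev : Even ((k - l).natAbs + (k + l).natAbs) := by
    rw [Nat.even_iff]; omega
  have h1 : ((-1 : ℝ) ^ m) ^ (k - l).natAbs * ((-1 : ℝ) ^ m) ^ (k + l).natAbs = 1 := by
    rw [← pow_add, ← zpow_natCast, ← zpow_mul, mul_comm, zpow_mul, zpow_natCast, hev.neg_one_pow,
      one_zpow]
  have h2 : ∀ A B : ℝ, A * ((-1) ^ m * Real.sin (β / 2)) ^ (k - l).natAbs *
      ((-1) ^ m * Real.cos (β / 2)) ^ (k + l).natAbs * B =
        A * Real.sin (β / 2) ^ (k - l).natAbs * Real.cos (β / 2) ^ (k + l).natAbs * B := by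
    intro A B
    rw [mul_pow, mul_pow]
    linear_combination (A * Real.sin (β / 2) ^ (k - l).natAbs *
      Real.cos (β / 2) ^ (k + l).natAbs * B) * h1
  simp only [wignerTrig, e, Real.sin_add_int_mul_pi, Real.cos_add_int_mul_pi,
    Real.cos_add_int_mul_two_pi, h2]

theorem wignerSmallD_cos_of_mem {n : ℕ} {k l : ℤ} {β : ℝ} (hβ : β ∈ Set.Icc 0 Real.pi) :
    wignerSmallD n k l (Real.cos β) = wignerTrig n k l β := by
  have hs : 0 ≤ Real.sin (β / 2) :=
    Real.sin_nonneg_of_nonneg_of_le_pi (by linarith [hβ.1]) (by linarith [hβ.1, hβ.2])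
  have hc : 0 ≤ Real.cos (β / 2) :=
    Real.cos_nonneg_of_neg_pi_div_two_le_of_le (by linarith [hβ.1, hβ.2, Real.pi_pos])
      (by linarith [hβ.2])
  simp only [wignerSmallD, wignerTrig, sqrt_half_sub_cos, sqrt_half_add_cos, abs_of_nonneg hs,
    abs_of_nonneg hc]

/-- Only the power `|k - l|` of the sine is odd or even in `β`, and it has the parity of `k + l`. -/
theorem wignerTrig_neg (n : ℕ) (k l : ℤ) (β : ℝ) :
    wignerTrig n k l (-β) = (-1 : ℝ) ^ (k + l) * wignerTrig n k l β := by
  have h : (-1 : ℝ) ^ (k - l).natAbs = (-1 : ℝ) ^ (k + l) := by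
    rw [← zpow_natCast]
    rcases Int.even_or_odd (k + l) with h | h
    · rw [h.neg_one_zpow, Even.neg_one_zpow]
      rw [Int.even_iff] at *; omega
    · rw [h.neg_one_zpow, Odd.neg_one_zpow]
      rw [Int.odd_iff] at *; omega
  simp only [wignerTrig, neg_div, Real.sin_neg, Real.cos_neg]
  rw [neg_pow, h]
  ring

/-- Conjugating a rotation about the `y`-axis by the half turn about the `z`-axis inverts it. -/
theorem euler_neg (α β γ : Real.Angle) :
    euler α (-β) γ = euler (α + Real.pi) β (γ + Real.pi) := by
  ext i j
  fin_cases i <;> fin_cases j <;> simp [euler, rotZ, rotY]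

/-- Removes the restriction `β ∈ [0, π]`, as the DFS transform needs. Periodicity reduces `β` to
`(-π, π]`, and a negative `β` is reflected by `euler_neg`. The two shifts by `π` contribute
`(-1)^(k+l)`, which cancels the sign in `wignerTrig_neg`. -/
theorem wignerD_euler_eq_wignerTrig (n : ℕ) (k l : ℤ) (α β γ : ℝ) :
    wignerD n k l (euler α β γ) = (√(2 * n + 1 : ℝ) : ℂ) * expI (-k) α *
      (wignerTrig n k l β : ℂ) * expI (-l) γ := by
  have base : ∀ α β γ : ℝ, β ∈ Set.Icc 0 Real.pi → wignerD n k l (euler α β γ) =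
      (√(2 * n + 1 : ℝ) : ℂ) * expI (-k) α * (wignerTrig n k l β : ℂ) * expI (-l) γ := by
    intro α β γ hβ
    rw [wignerD_euler _ _ _ _ _ _ hβ, wignerDEuler, wignerSmallD_cos_of_mem hβ]
    simp only [expI]
    push_cast
    simp only [mul_neg, neg_mul]
  have hpi : ∀ (m : ℤ) (x : ℝ), expI m (x + Real.pi) = (-1) ^ m * expI m x := by
    intro m x
    rw [expI_eq_zpow, expI_eq_zpow, ← mul_zpow]
    congr 1
    push_cast
    rw [mul_add, Complex.exp_add, mul_comm Complex.I (Real.pi : ℂ), Complex.exp_pi_mul_I]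
    ring
  set β' : ℝ := (β : Real.Angle).toReal with hβ'
  obtain ⟨m, hm⟩ : ∃ m : ℤ, β = β' + m * (2 * Real.pi) := by
    have : ((β : ℝ) : Real.Angle) = (β' : ℝ) := by simp [hβ']
    obtain ⟨m, hm⟩ := Real.Angle.angle_eq_iff_two_pi_dvd_sub.1 this
    exact ⟨m, by linarith⟩
  have hE : euler α β γ = euler α β' γ := by simp [hβ']
  have hle : β' ≤ Real.pi := Real.Angle.toReal_le_pi _
  have hge : -Real.pi < β' := Real.Angle.neg_pi_lt_toReal _
  have hT : wignerTrig n k l β = wignerTrig n k l β' := by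
    rw [hm, wignerTrig_add_int_mul_two_pi]
  rw [hE, hT]
  rcases le_total 0 β' with h | h
  · exact base α β' γ ⟨h, hle⟩
  · have hE' : euler α β' γ = euler (α + Real.pi : ℝ) (-β' : ℝ) (γ + Real.pi : ℝ) := by
      rw [Real.Angle.coe_add, Real.Angle.coe_add, Real.Angle.coe_neg, ← euler_neg, neg_neg]
    rw [hE', base _ _ _ ⟨by linarith, by linarith⟩, hpi, hpi, wignerTrig_neg]
    have h1 : (-1 : ℂ) ^ (-k) * (-1) ^ (-l) * (-1) ^ (k + l) = 1 := by
      rw [← zpow_add₀ (by norm_num), ← zpow_add₀ (by norm_num), show -k + -l + (k + l) = 0 by ring, zpow_zero]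
    push_cast
    linear_combination ((√(2 * n + 1 : ℝ) : ℂ) * expI (-k) α *
      (wignerTrig n k l β' : ℂ) * expI (-l) γ) * h1

theorem wignerTrig_mem_trigPoly {n : ℕ} {k l : ℤ} (hk : |k| ≤ n) (hl : |l| ≤ n) :
    (fun β : ℝ => (wignerTrig n k l β : ℂ)) ∈ trigPoly n := by
  set a : ℕ := (k - l).natAbs with ha
  set b : ℕ := (k + l).natAbs with hb
  set s : ℕ := n - max k.natAbs l.natAbs with hs
  -- Since `|k - l| + |k + l| = 2 max(|k|, |l|)`, every Jacobi term, rewritten in half angles, is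
  -- homogeneous of degree `2n`.
  have hab : a + b + 2 * s = 2 * n := by
    rw [abs_le] at hk hl; omega
  set C : ℝ := (if l < k then (-1 : ℝ) ^ (k + l) else 1) *
    √((2 * n - s).choose (s + a) : ℝ) * (√((s + b).choose b : ℝ))⁻¹ with hC
  have : (fun β : ℝ => (wignerTrig n k l β : ℂ)) = ∑ m ∈ Finset.range (s + 1),
      ((C * (((s + a).choose (s - m) : ℝ) * ((s + b).choose m : ℝ)) * (-1) ^ m : ℝ) : ℂ) •
        fun x : ℝ => ((Real.sin (x / 2) ^ (a + 2 * m) *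
          Real.cos (x / 2) ^ (b + 2 * (s - m)) : ℝ) : ℂ) := by
    funext β
    have h1 : (Real.cos β - 1) / 2 = -1 * Real.sin (β / 2) ^ 2 := by
      rw [Real.sin_sq_eq_half_sub, mul_div_cancel₀ _ two_ne_zero]; ring
    have h2 : (Real.cos β + 1) / 2 = Real.cos (β / 2) ^ 2 := by
      rw [Real.cos_sq, mul_div_cancel₀ _ two_ne_zero]; ring
    simp only [wignerTrig, ← ha, ← hb, ← hs, ← hC, jacobi, h1, h2, Finset.sum_apply,
      Pi.smul_apply, smul_eq_mul, ← Complex.ofReal_mul, ← Complex.ofReal_sum]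
    congr 1
    rw [Finset.mul_sum]
    refine Finset.sum_congr rfl fun m _ => ?_
    rw [mul_pow, ← pow_mul, ← pow_mul]
    ring
  rw [this]
  refine Submodule.sum_mem _ fun m hm => Submodule.smul_mem _ _
    (sin_pow_mul_cos_pow_mem_trigPoly ?_)
  rw [Finset.mem_range] at hm
  omega

/-! ### The DFS transform of band-limited functions -/

/-- The index set `{-N, …, N}³` of Fourier coefficients. -/
noncomputable def freqCube (N : ℕ) : Finset (ℤ × ℤ × ℤ) :=
  Finset.Icc (-N : ℤ) N ×ˢ Finset.Icc (-N : ℤ) N ×ˢ Finset.Icc (-N : ℤ) N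

theorem mem_freqCube {N : ℕ} {k j l : ℤ} :
    (k, j, l) ∈ freqCube N ↔ |k| ≤ N ∧ |j| ≤ N ∧ |l| ≤ N := by
  simp [freqCube, abs_le]

theorem trigPoly_mono {n N : ℕ} (h : n ≤ N) : trigPoly n ≤ trigPoly N :=
  Submodule.span_mono <| Set.image_mono fun m (hm : |m| ≤ n) =>
    show |m| ≤ N from hm.trans (by exact_mod_cast h)

/-- The DFS transform of a band-limited function is a trigonometric polynomial. -/
theorem exists_dfsTransform_eq_sum {N : ℕ} {f : SO3 → ℂ} (hf : f ∈ bandLimited N) :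
    ∃ c : ℤ × ℤ × ℤ → ℂ, ∀ α β γ : ℝ, dfsTransform f α β γ =
      ∑ p ∈ freqCube N, c p * expI p.1 α * expI p.2.1 β * expI p.2.2 γ := by
  let T : Submodule ℂ (ℝ → ℝ → ℝ → ℂ) := {
    carrier := {g | ∃ c : ℤ × ℤ × ℤ → ℂ, ∀ α β γ : ℝ, g α β γ =
      ∑ p ∈ freqCube N, c p * expI p.1 α * expI p.2.1 β * expI p.2.2 γ}
    add_mem' := by
      rintro g g' ⟨c, hc⟩ ⟨c', hc'⟩
      exact ⟨c + c', fun α β γ => by simp [hc, hc', add_mul, Finset.sum_add_distrib]⟩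
    zero_mem' := ⟨0, by simp⟩
    smul_mem' := by
      rintro t g ⟨c, hc⟩
      exact ⟨t • c, fun α β γ => by simp [hc, Finset.mul_sum, mul_assoc]⟩ }
  have hT : ∀ (k l : ℤ) (F : ℝ → ℂ), |k| ≤ N → |l| ≤ N → F ∈ trigPoly N →
      (fun α β γ => expI k α * F β * expI l γ) ∈ T := by
    intro k l F hk hl hF
    induction hF using Submodule.span_induction with
    | mem F hF =>
      obtain ⟨j, hj, rfl⟩ := hF
      refine ⟨Pi.single (k, j, l) 1, fun α β γ => ?_⟩
      rw [Finset.sum_eq_single_of_mem (k, j, l) (mem_freqCube.2 ⟨hk, hj, hl⟩)]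
      · simp
      · intro p _ hp
        simp [hp]
    | zero =>
      convert T.zero_mem using 1
      funext α β γ
      simp
    | add F G _ _ hF hG =>
      convert T.add_mem hF hG using 1
      funext α β γ
      simp only [Pi.add_apply]
      ring
    | smul t F _ hF =>
      convert T.smul_mem t hF using 1
      funext α β γ
      simp only [Pi.smul_apply, smul_eq_mul]
      ring
  have h : bandLimited N ≤ ({
      carrier := {g | (fun α β γ : ℝ => g (euler α β γ)) ∈ T}
      add_mem' := fun ha hb => T.add_mem ha hb
      zero_mem' := T.zero_mem
      smul_mem' := fun c _ hg => T.smul_mem c hg } : Submodule ℂ (SO3 → ℂ)) := by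
    refine bandLimited_le fun n k l hn hk hl => ?_
    have hnN : (n : ℤ) ≤ N := by exact_mod_cast hn
    have := T.smul_mem (√(2 * n + 1 : ℝ) : ℂ) (hT (-k) (-l) _ (by simpa using hk.trans hnN)
      (by simpa using hl.trans hnN) (trigPoly_mono hn (wignerTrig_mem_trigPoly hk hl)))
    change (fun α β γ : ℝ => wignerD n k l (euler α β γ)) ∈ T
    convert this using 1
    funext α β γ
    rw [wignerD_euler_eq_wignerTrig]
    simp only [Pi.smul_apply, smul_eq_mul]
    ring
  exact h hf

/-- The Fourier coefficients recover the trigonometric polynomial `f ∘ R`, and every rotation has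
Euler angles. -/
theorem eq_of_fourierCoeffTorus_eq {N : ℕ} {f g : SO3 → ℂ} (hf : f ∈ bandLimited N)
    (hg : g ∈ bandLimited N)
    (h : ∀ k j l : ℤ, |k| ≤ N → |j| ≤ N → |l| ≤ N →
      fourierCoeffTorus (dfsTransform f) k j l = fourierCoeffTorus (dfsTransform g) k j l) :
    f = g := by
  obtain ⟨c, hc⟩ := exists_dfsTransform_eq_sum hf
  obtain ⟨d, hd⟩ := exists_dfsTransform_eq_sum hg
  funext R
  obtain ⟨α, β, γ, -, rfl⟩ := exists_euler R
  change dfsTransform f α β γ = dfsTransform g α β γ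
  rw [hc, hd]
  refine Finset.sum_congr rfl ?_
  rintro ⟨k, j, l⟩ hp
  have hp' := mem_freqCube.1 hp
  have := h k j l hp'.1 hp'.2.1 hp'.2.2
  rw [fourierCoeffTorus_sum _ c hc, fourierCoeffTorus_sum _ d hd, if_pos hp, if_pos hp] at this
  rw [this]

/-- Conjugation sends the frequency `p` to `-p`, and the frequency cube is symmetric under negation.
-/
theorem fourierCoeffTorus_star {N : ℕ} {f : SO3 → ℂ} (hf : f ∈ bandLimited N) (k j l : ℤ) :
    fourierCoeffTorus (dfsTransform fun R => starRingEnd ℂ (f R)) k j l =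
      starRingEnd ℂ (fourierCoeffTorus (dfsTransform f) (-k) (-j) (-l)) := by
  obtain ⟨c, hc⟩ := exists_dfsTransform_eq_sum hf
  have hmem : ∀ p, -p ∈ freqCube N ↔ p ∈ freqCube N := by
    rintro ⟨k, j, l⟩
    change (-k, -j, -l) ∈ _ ↔ _
    simp [mem_freqCube]
  have hd : ∀ α β γ : ℝ, dfsTransform (fun R => starRingEnd ℂ (f R)) α β γ =
      ∑ p ∈ freqCube N, starRingEnd ℂ (c (-p)) * expI p.1 α * expI p.2.1 β * expI p.2.2 γ := by
    intro α β γ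
    change starRingEnd ℂ (dfsTransform f α β γ) = _
    rw [hc, map_sum]
    refine Finset.sum_equiv (Equiv.neg _) (fun p => (hmem p).symm) fun p _ => ?_
    simp [conj_expI]
  rw [fourierCoeffTorus_sum _ c hc, fourierCoeffTorus_sum _ _ hd]
  have := hmem (k, j, l)
  rw [Prod.neg_mk, Prod.neg_mk] at this
  simp only [this]
  split_ifs <;> simp

/-! ### Injectivity and symmetry of the coefficient maps -/

theorem eq_of_harmonicCoeff_eq {N : ℕ} {f g : SO3 → ℂ} (hf : f ∈ bandLimited N)
    (hg : g ∈ bandLimited N)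
    (h : ∀ (n : ℕ) (k l : ℤ), n ≤ N → |k| ≤ n → |l| ≤ n →
      harmonicCoeff f n k l = harmonicCoeff g n k l) : f = g := by
  refine sub_eq_zero.1 (eq_zero_of_harmonicCoeff_eq_zero (Submodule.sub_mem _ hf hg) ?_)
  intro n k l hn hk hl
  have hD := continuous_wignerD n k l
  have hfc := continuous_of_mem_bandLimited hf
  have hgc := continuous_of_mem_bandLimited hg
  have := h n k l hn hk hl
  simp only [harmonicCoeff, innerL2, Pi.sub_apply, sub_mul] at *
  rw [MeasureTheory.integral_sub (integrable_haar (by fun_prop)) (integrable_haar (by fun_prop)),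
    this, sub_self]

/-- The Wigner transform is injective. -/
theorem eq_of_wignerTransform_eq {N : ℕ} {c d : ℕ → ℤ → ℤ → ℂ}
    (h : ∀ k j l : ℤ, |k| ≤ N → |j| ≤ N → |l| ≤ N →
      wignerTransform N c k j l = wignerTransform N d k j l)
    {n : ℕ} {k l : ℤ} (hn : n ≤ N) (hk : |k| ≤ n) (hl : |l| ≤ n) : c n k l = d n k l := by
  induction hm : N - n using Nat.strong_induction_on generalizing n with
  | _ m ih =>
    -- Descending induction on the degree. Taking `j = n` makes the sum start at degree `n`; the
    -- higher degrees agree by induction. The orders are negated because the transform reads its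
    -- input at `(-k, -l)`.
    have hnN : (n : ℤ) ≤ N := by exact_mod_cast hn
    have key := h (-k) n (-l) (by simpa using hk.trans hnN) (by simpa using hnN)
      (by simpa using hl.trans hnN)
    have hmax : max (max (-k).natAbs (-l).natAbs) (n : ℤ).natAbs = n := by
      rw [abs_le] at hk hl
      omega
    rw [wignerTransform, wignerTransform, hmax,
      mul_right_inj' (zpow_ne_zero _ Complex.I_ne_zero),
      ← Finset.insert_Icc_add_one_left_eq_Icc hn, Finset.sum_insert (by simp),
      Finset.sum_insert (by simp), neg_neg, neg_neg] at key
    have htail : ∀ n' ∈ Finset.Icc (n + 1) N, c n' k l = d n' k l := by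
      intro n' hn'
      rw [Finset.mem_Icc] at hn'
      have hnn : (n : ℤ) ≤ n' := by exact_mod_cast (Nat.le_of_succ_le hn'.1)
      exact ih (N - n') (by omega) hn'.2 (hk.trans hnn) (hl.trans hnn) rfl
    rw [Finset.sum_congr rfl fun n' hn' => by rw [htail n' hn'], add_left_inj] at key
    refine mul_left_cancel₀ (mul_ne_zero (mul_ne_zero ?_ ?_) ?_) key
    · exact_mod_cast (Real.sqrt_pos.2 (by positivity : (0 : ℝ) < 2 * n + 1)).ne'
    · exact_mod_cast wignerSmallD_self_left_ne_zero (by simpa using hk)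
    · exact_mod_cast wignerSmallD_self_left_ne_zero (by simpa using hl)

/-- The sign from `harmonicCoeff_star` cancels the signs from negating the orders of both Wigner-d
factors, where `j` enters twice. Conjugating the power of `I` inverts it, which matches the negated
exponent. -/
theorem wignerTransform_star (N : ℕ) (f : SO3 → ℂ) (k j l : ℤ) :
    wignerTransform N (harmonicCoeff fun R => starRingEnd ℂ (f R)) k j l =
      starRingEnd ℂ (wignerTransform N (harmonicCoeff f) (-k) (-j) (-l)) := by
  have hI : starRingEnd ℂ (Complex.I ^ (-k - -l)) = Complex.I ^ (k - l) := by
    rw [map_zpow₀, Complex.conj_I, ← Complex.inv_I, inv_zpow', neg_sub_neg, neg_sub]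
  rw [wignerTransform, wignerTransform, map_mul, hI, map_sum]
  simp only [Int.natAbs_neg]
  congr 1
  refine Finset.sum_congr rfl fun n _ => ?_
  rw [harmonicCoeff_star, wignerSmallD_neg_neg, wignerSmallD_neg_neg]
  simp only [map_mul, Complex.conj_ofReal, neg_neg]
  have h1 : (-1 : ℂ) ^ (j + k) * (-1) ^ (j + l) = (-1) ^ (-k + -l) := by
    rw [← zpow_add₀ (by norm_num), show j + k + (j + l) = 2 * (j + (k + l)) + (-k + -l) by ring,
      zpow_add₀ (by norm_num), zpow_mul]
    simp
  push_cast
  rw [← h1]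
  ring

end WignerDFS

open WignerDFS

theorem mainTheorem7 (N : ℕ) (f : WignerDFS.SO3 → ℂ) (hf : f ∈ WignerDFS.bandLimited N) :
    List.TFAE [
      -- `f` is real-valued
      ∀ R : WignerDFS.SO3, ∃ r : ℝ, f R = r,
      -- symmetry of the harmonic coefficients of `f`
      ∀ (n : ℕ) (k l : ℤ), n ≤ N → |k| ≤ n → |l| ≤ n →
        WignerDFS.harmonicCoeff f n k l =
          (-1 : ℂ) ^ (k + l) * starRingEnd ℂ (WignerDFS.harmonicCoeff f n (-k) (-l)),
      -- symmetry of the Wigner transform of the harmonic coefficients of `f`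
      ∀ k j l : ℤ, |k| ≤ N → |j| ≤ N → |l| ≤ N →
        WignerDFS.wignerTransform N (WignerDFS.harmonicCoeff f) k j l =
          starRingEnd ℂ
            (WignerDFS.wignerTransform N (WignerDFS.harmonicCoeff f) (-k) (-j) (-l)),
      -- symmetry of the Fourier coefficients of the DFS transform of `f`
      ∀ k j l : ℤ, |k| ≤ N → |j| ≤ N → |l| ≤ N →
        WignerDFS.fourierCoeffTorus (WignerDFS.dfsTransform f) k j l =
          starRingEnd ℂ
            (WignerDFS.fourierCoeffTorus (WignerDFS.dfsTransform f) (-k) (-j) (-l))] := by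
  have hs := star_mem_bandLimited hf
  have hreal : (∀ R, ∃ r : ℝ, f R = r) ↔ f = fun R => starRingEnd ℂ (f R) := by
    rw [funext_iff]
    exact forall_congr' fun R => by rw [eq_comm (a := f R), Complex.conj_eq_iff_real]
  -- From here on, every condition compares `f` with its conjugate.
  simp only [hreal, ← harmonicCoeff_star, ← wignerTransform_star, ← fourierCoeffTorus_star hf]
  tfae_have 1 → 3 := fun h k j l _ _ _ => by rw [← h]
  tfae_have 3 → 2 := fun h n k l hn hk hl => eq_of_wignerTransform_eq h hn hk hl
  tfae_have 2 → 1 := eq_of_harmonicCoeff_eq hf hs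
  tfae_have 1 → 4 := fun h k j l _ _ _ => by rw [← h]
  tfae_have 4 → 1 := eq_of_fourierCoeffTorus_eq hf hs
  tfae_finish
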